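/- Let $\mathcal F$ be a (possibly infinite) signature whose arities are bounded, let $A$ be the maximal arity, and let $\succ$ be a precedence (a strict partial order on $\mathcal F$) with an admissible weight function $(w,w_0)$: $w:\mathcal F\to\mathbb N$, $w_0>0$, $w(c)\ge w_0$ for constants $c$, and a unary symbol $\delta$ with $w(\delta)=0$ (the \emph{special} symbol, if present) satisfies $\delta\succ g$ for all $g\ne\delta$. Let $\mathrm{wt}(t)$ be the induced weight of terms (variables have weight $w_0$) and let $>_{\mathrm{kbo}}$ be the induced Knuth-Bendix order. Assume that $\succ$ is well-founded and that for every non-special symbol $f$ the rank $\mathrm{rk}(f)=\max\{\mathrm{rk}(g)+1\mid f\succ g\}\in\mathbb N$ exists ($\max\emptyset=0$). Every term is uniquely $\delta^a x$ with $x$ a variable, or $\delta^a g(t_1,\dots,t_n)$ with $g$ not special. Put $\mathrm{sp}(\delta^a x)=a$, $\mathrm{sp}(\delta^a g(t_1,\dots,t_n))=\max\{a,\mathrm{sp}(t_1),\dots,\mathrm{sp}(t_n)\}$; $\mathrm{rk}(\delta^a x)=0$, $\mathrm{rk}(\delta^a g(\dots))=\mathrm{rk}(g)$; let $\mathrm{mrk}(t)$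 be the maximal rank of a non-special symbol in $t$ ($0$ if there is none). With $b=\max\{A,3\}+1$ let $$\mathrm{tw}(\delta^a x)=(w_0,a,0)\,0^m,\qquad \mathrm{tw}(t)=(\mathrm{wt}(t),a,\mathrm{rk}(g))\,\mathrm{tw}(t_1)\cdots\mathrm{tw}(t_n)\,0^m\quad\text{for } t=\delta^a g(t_1,\dots,t_n),$$ sequences of natural numbers, $m$ being chosen so that $|\mathrm{tw}(t)|=b^{\mathrm{wt}(t)+1}$. Let $\mathrm{mc}(p)$ be the maximal entry of a sequence $p$. Let $\mathcal R$ be a (possibly infinite) set of rewrite rules over $\mathcal F$ with $l>_{\mathrm{kbo}}r$ for all $l\to r\in\mathcal R$, such that the set $$M=\{\mathrm{sp}(r)\mid l\to r\in\mathcal R\}\cup\{\max(\mathrm{mrk}(r)-\mathrm{rk}(l),0)\mid l\to r\in\mathcal R\}$$ is finite; put $K=\max M$ ($K=0$ if $M=\emptyset$). Let $\mathrm{Dh}_{\mathcal R}(t)$ be the maximal length of an $\mathcal R$-derivation starting from $t$, and let $\mathrm{Ack}$ be the Ackermann function, $\mathrm{Ack}(0,m)=m+1$, $\mathrm{Ack}(n+1,0)=\mathrm{Ack}(n,1)$,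 $\mathrm{Ack}(n+1,m+1)=\mathrm{Ack}(n,\mathrm{Ack}(n+1,m))$. Then for every term $t$ (in particular for every ground term), $\mathrm{Dh}_{\mathcal R}(t)$ is finite and $$\mathrm{Dh}_{\mathcal R}(t)\le \mathrm{Ack}\bigl(C\cdot|\mathrm{tw}(t)|+\mathrm{mc}(\mathrm{tw}(t))+K,\,0\bigr),$$ where $C$ is an absolute constant. Consequently there is a constant $c$, depending only on $\mathcal F$, $\mathcal R$, the Knuth-Bendix order, the maximal weight of the symbols and variables occurring in $t$, and $\mathrm{mrk}(t)$, such that $\mathrm{Dh}_{\mathcal R}(t)\le\mathrm{Ack}(c^{n},0)$, where $n$ is the size of $t$ (the number of occurrences of variables and function symbols). -/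

import Mathlib

namespace Rewriting

/-- First-order terms over a signature `F` with arity function `ar` and variables from `V`. -/
inductive Term (F : Type*) (ar : F → ℕ) (V : Type*) where
  | var : V → Term F ar V
  | app : (f : F) → (Fin (ar f) → Term F ar V) → Term F ar V

namespace Term

variable {F : Type*} {ar : F → ℕ} {V : Type*}

/-- Application of a substitution. -/
def subst (σ : V → Term F ar V) : Term F ar V → Term F ar V
  | var x => σ x
  | app f ts => app f (fun i => (ts i).subst σ)

/-- The size of a term: the number of occurrences of variables and function symbols. -/
def size : Term F ar V → ℕ
  | var _ => 1
  | app _ ts => 1 + ∑ i, (ts i).size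

open Classical in
/-- The number of occurrences of the variable `x` in a term. -/
noncomputable def count (x : V) : Term F ar V → ℕ
  | var y => if y = x then 1 else 0
  | app _ ts => ∑ i, (ts i).count x

/-- The term `f (f (... (f t)))` with `n` occurrences of the unary symbol `f` in front of `t`. -/
def iter (f : F) (_hf : ar f = 1) : ℕ → Term F ar V → Term F ar V
  | 0, t => t
  | n + 1, t => app f (fun _ => iter f _hf n t)

end Term

/-- One rewrite step: the closure of the set of rules `R` under substitutions and contexts. -/
inductive Step {F : Type*} {ar : F → ℕ} {V : Type*} (R : Set (Term F ar V × Term F ar V)) :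
    Term F ar V → Term F ar V → Prop
  | rule (l r : Term F ar V) (σ : V → Term F ar V) :
      (l, r) ∈ R → Step R (l.subst σ) (r.subst σ)
  | context (f : F) (ts : Fin (ar f) → Term F ar V) (i : Fin (ar f)) (u : Term F ar V) :
      Step R (ts i) u → Step R (Term.app f ts) (Term.app f (Function.update ts i u))

/-- The derivation height of `t`: the supremum, in `ℕ∞`, of the lengths `n` of all derivations
`t = s 0 → s 1 → ... → s n`. -/
noncomputable def dh {F : Type*} {ar : F → ℕ} {V : Type*}
    (R : Set (Term F ar V × Term F ar V)) (t : Term F ar V) : ℕ∞ :=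
  ⨆ n ∈ {n : ℕ | ∃ s : ℕ → Term F ar V, s 0 = t ∧ ∀ i < n, Step R (s i) (s (i + 1))}, (n : ℕ∞)

/-- A precedence (well-founded strict partial order) together with an admissible weight function:
the data that determine a Knuth-Bendix order. -/
structure KBO (F : Type*) (ar : F → ℕ) where
  /-- The precedence; `prec f g` means that `f` is greater than `g`. -/
  prec : F → F → Prop
  prec_trans : ∀ f g h, prec f g → prec g h → prec f h
  prec_wf : WellFounded (fun g f => prec f g)
  weight : F → ℕ
  /-- The weight of every variable. -/
  w0 : ℕ
  w0_pos : 0 < w0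
  w0_le_const : ∀ c, ar c = 0 → w0 ≤ weight c
  admissible : ∀ d, ar d = 1 → weight d = 0 → ∀ g, g ≠ d → prec d g

namespace KBO

variable {F : Type*} {ar : F → ℕ} {V : Type*} (O : KBO F ar)

/-- The special symbol (there is at most one) is the unary symbol of weight `0`. -/
abbrev IsSpecial (f : F) : Prop := ar f = 1 ∧ O.weight f = 0

/-- The index of the only argument of a unary symbol. -/
def only {f : F} (h : ar f = 1) : Fin (ar f) := ⟨0, by omega⟩

/-- The rank of a symbol: `rank f = max {rank g + 1 | f ≻ g}`, with `max ∅ = 0`.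
Meaningful if the set is bounded. -/
noncomputable def rank : F → ℕ :=
  O.prec_wf.fix fun f ih => sSup {n : ℕ | ∃ (g : F) (h : O.prec f g), n = ih g h + 1}

theorem rank_eq (f : F) : O.rank f = sSup {n : ℕ | ∃ g, O.prec f g ∧ n = O.rank g + 1} := by
  unfold rank
  rw [WellFounded.fix_eq]
  simp only [exists_prop]

/-- The maximum that defines the rank exists for every symbol other than the special one. -/
def RanksExist : Prop :=
  ∀ f, ¬ O.IsSpecial f → BddAbove {n : ℕ | ∃ g, O.prec f g ∧ n = O.rank g + 1}

/-- The weight of a term. -/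
def wt : Term F ar V → ℕ
  | .var _ => O.w0
  | .app f ts => O.weight f + ∑ i, wt (ts i)

/-- The Knuth-Bendix order on terms. -/
inductive Gt : Term F ar V → Term F ar V → Prop
  | weight (s t : Term F ar V) :
      (∀ x, t.count x ≤ s.count x) → O.wt t < O.wt s → Gt s t
  | var (f : F) (hf : ar f = 1) (n : ℕ) (x : V) :
      O.wt (Term.iter f hf (n + 1) (Term.var x) : Term F ar V)
        = O.wt (Term.var x : Term F ar V) →
      Gt (Term.iter f hf (n + 1) (Term.var x)) (Term.var x)
  | prec (f g : F) (ss : Fin (ar f) → Term F ar V) (ts : Fin (ar g) → Term F ar V) :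
      (∀ x, (Term.app g ts).count x ≤ (Term.app f ss).count x) →
      O.wt (Term.app f ss) = O.wt (Term.app g ts) →
      O.prec f g → Gt (Term.app f ss) (Term.app g ts)
  | lex (f : F) (ss ts : Fin (ar f) → Term F ar V) (i : Fin (ar f)) :
      (∀ x, (Term.app f ts).count x ≤ (Term.app f ss).count x) →
      O.wt (Term.app f ss) = O.wt (Term.app f ts) →
      (∀ j < i, ss j = ts j) → Gt (ss i) (ts i) →
      Gt (Term.app f ss) (Term.app f ts)

/-- The TRS `R` is compatible with the Knuth-Bendix order. -/
def Compatible (R : Set (Term F ar V × Term F ar V)) : Prop :=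
  ∀ l r, (l, r) ∈ R → O.Gt l r

/-- `specAux t a` is the maximal nesting of special symbols in `t` preceded by `a` special
symbols. -/
def specAux : Term F ar V → ℕ → ℕ
  | .var _, a => a
  | .app f ts, a =>
      if h : O.IsSpecial f then specAux (ts (only h.1)) (a + 1)
      else max a (Finset.univ.sup fun i => specAux (ts i) 0)

/-- The maximal nesting of special symbols in a term. -/
def spec (t : Term F ar V) : ℕ := O.specAux t 0

/-- The rank of the first non-special function symbol of a term (`0` if there is none). -/
noncomputable def rk : Term F ar V → ℕ
  | .var _ => 0
  | .app f ts => if h : O.IsSpecial f then rk (ts (only h.1)) else O.rank f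

/-- The maximal rank of the non-special function symbols of a term. -/
noncomputable def mrk : Term F ar V → ℕ
  | .var _ => 0
  | .app f ts =>
      if h : O.IsSpecial f then mrk (ts (only h.1))
      else max (O.rank f) (Finset.univ.sup fun i => mrk (ts i))

/-- The maximal weight of the function symbols and variables that occur in a term. -/
def wmax : Term F ar V → ℕ
  | .var _ => O.w0
  | .app f ts => max (O.weight f) (Finset.univ.sup fun i => wmax (ts i))

/-- `max (maximal arity) 3 + 1`; meaningful if the arities are bounded. -/
noncomputable def base (ar : F → ℕ) : ℕ := max (sSup (Set.range ar)) 3 + 1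

/-- Fill the list `p` up with zeros to the length `n`. -/
def pad (n : ℕ) (p : List ℕ) : List ℕ := p ++ List.replicate (n - p.length) 0

/-- `twAux t a` is the sequence assigned to `t` preceded by `a` special symbols. -/
noncomputable def twAux : Term F ar V → ℕ → List ℕ
  | .var _, a => pad (base ar ^ (O.w0 + 1)) [O.w0, a, 0]
  | .app f ts, a =>
      if h : O.IsSpecial f then twAux (ts (only h.1)) (a + 1)
      else pad (base ar ^ (O.wt (Term.app f ts) + 1))
        ([O.wt (Term.app f ts), a, O.rank f] ++
          (List.ofFn fun i => twAux (ts i) 0).flatten)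

/-- The sequence of natural numbers assigned to a term: triples (weight of the subterm, number of
leading special symbols, rank of the first non-special symbol), filled up with zeros. -/
noncomputable def tw (t : Term F ar V) : List ℕ := O.twAux t 0

/-- The maximal number occurring in a sequence. -/
def mc (p : List ℕ) : ℕ := p.foldr max 0

/-- The special-symbol nestings of the right-hand sides and the rank increases of the rules. -/
def increases (R : Set (Term F ar V × Term F ar V)) : Set ℕ :=
  {n | ∃ l r, (l, r) ∈ R ∧ n = O.spec r} ∪ {n | ∃ l r, (l, r) ∈ R ∧ n = O.mrk r - O.rk l}

end KBO

end Rewriting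

/-!
Every rewrite step makes the sequence `KBO.tw` lexicographically smaller: this is checked for
substitution instances of pairs in the Knuth-Bendix order (`KBO.Gt.descends_subst`) and then for
contexts (`KBO.descends_of_step`). The sequence of a term of weight `w` has length
`base ar ^ (w + 1)` and weights never increase along a derivation, so, up to implicit padding by
zeros, the whole derivation starting from `t` lives in the lexicographically ordered tuples of
length `N = |tw t|`, an order of type `ω ^ N`.

The entries of the sequence are controlled by the weight, the nesting of special symbols and the
maximal rank. A step at most doubles the nesting of special symbols and adds `K`, because special
symbols of the context, of the right-hand side and of the substitution may meet
(`KBO.specAux_le_of_step`); it raises the maximal rank by at most `K` (`KBO.mrk_le_of_step`).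
Hence after adding `K` to the initial bound, the bound merely doubles in each step.

A lexicographic descent with this control is measured by the Hardy-like function `hardy N p y`,
in which an entry `a` followed by `n` further places contributes `a` iterations of
`ack (2 * n + 2)`. It does not increase when the tuple `p` descends and `y` doubles
(`hardy_le_of_lexDrop`), so a derivation of length `n` gives `2 ^ n * y ≤ hardy N p y`, and the
latter is at most `ack (2 * N + 2) y` (`hardy_le_ack`).
-/

namespace Rewriting

/-! ### Controlled lexicographic descent -/

/-- `LexDrop p q`: at the first position where they differ, `p` and `q` both have an entry, and the
one of `p` is larger. Unlike in `List.Lex`, a proper prefix is not comparable to its extensions, so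
that the relation survives appending arbitrary lists. -/
def LexDrop (p q : List ℕ) : Prop :=
  ∃ c a b p' q', p = c ++ a :: p' ∧ q = c ++ b :: q' ∧ b < a

theorem LexDrop.head {a b : ℕ} (h : b < a) (p q : List ℕ) : LexDrop (a :: p) (b :: q) :=
  ⟨[], a, b, p, q, rfl, rfl, h⟩

theorem LexDrop.append_left {p q : List ℕ} (h : LexDrop p q) (c : List ℕ) :
    LexDrop (c ++ p) (c ++ q) := by
  obtain ⟨d, a, b, p', q', rfl, rfl, hab⟩ := h
  exact ⟨c ++ d, a, b, p', q', by simp, by simp, hab⟩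

theorem LexDrop.append_right {p q : List ℕ} (h : LexDrop p q) (s s' : List ℕ) :
    LexDrop (p ++ s) (q ++ s') := by
  obtain ⟨d, a, b, p', q', rfl, rfl, hab⟩ := h
  exact ⟨d, a, b, p' ++ s, q' ++ s', by simp, by simp, hab⟩

theorem LexDrop.flatten_ofFn {n : ℕ} (f g : Fin n → List ℕ) (i : Fin n)
    (heq : ∀ j < i, f j = g j) (hi : LexDrop (f i) (g i)) :
    LexDrop (List.ofFn f).flatten (List.ofFn g).flatten := by
  induction n with
  | zero => exact i.elim0
  | succ n ih =>
    rw [List.ofFn_succ, List.ofFn_succ, List.flatten_cons, List.flatten_cons]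
    induction i using Fin.cases with
    | zero => exact hi.append_right _ _
    | succ i =>
      rw [heq 0 (Fin.succ_pos i)]
      exact (ih _ _ i (fun j hj => heq j.succ (Fin.succ_lt_succ_iff.2 hj)) hi).append_left _

theorem iterate_ack_le (M y : ℕ) (hM : 1 ≤ M) : (ack M)^[2 * y + 1] y ≤ ack (M + 2) y := by
  have shift : ∀ k j, (ack M)^[k] (ack (M + 1) j) = ack (M + 1) (j + k) := by
    intro k
    induction k with
    | zero => intro j; rfl
    | succ k ih =>
      intro j
      rw [Function.iterate_succ_apply, ← ack_succ_succ, ih, Nat.add_right_comm, Nat.add_assoc]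
  rcases y with _ | z
  · exact ack_mono_left 0 (by omega)
  · calc (ack M)^[2 * (z + 1) + 1] (z + 1)
        ≤ (ack M)^[2 * (z + 1) + 1] (ack (M + 1) (z + 1)) :=
          (ack_mono_right M).iterate _ (lt_ack_right _ _).le
      _ = ack (M + 1) (3 * z + 4) := by rw [shift]; congr 1; ring
      _ ≤ ack (M + 1) (ack (M + 2) z) := by
          apply ack_mono_right
          refine le_trans ?_ (ack_mono_left z (show 3 ≤ M + 2 by omega))
          simp only [ack_three]
          have := Nat.lt_two_pow_self (n := z)
          rw [pow_add]
          omega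
      _ = ack (M + 2) (z + 1) := (ack_succ_succ _ _).symm

/-- A Hardy-like function for tuples of length `N`; a shorter list stands for the tuple filled up
with zeros, and entries beyond the length `N` are ignored. -/
def hardy : ℕ → List ℕ → ℕ → ℕ
  | 0, _, y => y
  | _ + 1, [], y => y
  | N + 1, a :: p, y => (ack (2 * N + 2))^[a] (hardy N p y)

theorem le_iterate_ack (M k y : ℕ) : y ≤ (ack M)^[k] y :=
  Function.id_le_iterate_of_id_le (fun _ => (lt_ack_right _ _).le) k y

theorem iterate_ack_mono (M y : ℕ) {j k : ℕ} (h : j ≤ k) : (ack M)^[j] y ≤ (ack M)^[k] y :=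
  Function.monotone_iterate_of_id_le (fun _ => (lt_ack_right _ _).le) h y

theorem le_hardy (N : ℕ) (p : List ℕ) (y : ℕ) : y ≤ hardy N p y := by
  induction N generalizing p with
  | zero => exact le_rfl
  | succ N ih =>
    cases p with
    | nil => exact le_rfl
    | cons a p => exact (ih p).trans (le_iterate_ack _ _ _)

theorem hardy_le_ack (N : ℕ) (p : List ℕ) {y z : ℕ} (hz : z ≤ 2 * y)
    (hp : ∀ x ∈ p, x ≤ 2 * y) : hardy N p z ≤ ack (2 * N + 2) y := by
  have double : ∀ M, 2 * y ≤ ack (2 * M + 2) y := fun M =>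
    le_trans (by simp only [ack_two]; omega) (ack_mono_left y (show 2 ≤ 2 * M + 2 by omega))
  induction N generalizing p with
  | zero => exact hz.trans (double 0)
  | succ N ih =>
    cases p with
    | nil => exact hz.trans (double _)
    | cons a p =>
      calc (ack (2 * N + 2))^[a] (hardy N p z)
          ≤ (ack (2 * N + 2))^[a] (ack (2 * N + 2) y) :=
            (ack_mono_right _).iterate _ (ih p fun x hx => hp x (by simp [hx]))
        _ = (ack (2 * N + 2))^[a + 1] y := (Function.iterate_succ_apply _ _ _).symm
        _ ≤ (ack (2 * N + 2))^[2 * y + 1] y :=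
            iterate_ack_mono _ _ (Nat.succ_le_succ (hp a (by simp)))
        _ ≤ ack (2 * (N + 1) + 2) y := iterate_ack_le _ _ (by omega)

theorem hardy_le_of_lexDrop {N : ℕ} {p q : List ℕ} {y : ℕ} (h : LexDrop p q)
    (hp : p.length ≤ N) (hq : ∀ x ∈ q, x ≤ 2 * y) : hardy N q (2 * y) ≤ hardy N p y := by
  obtain ⟨c, a, b, p, q, rfl, rfl, hab⟩ := h
  induction c generalizing N with
  | nil =>
    obtain ⟨N, rfl⟩ : ∃ M, N = M + 1 := ⟨N - 1, by simp at hp; omega⟩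
    calc (ack (2 * N + 2))^[b] (hardy N q (2 * y))
        ≤ (ack (2 * N + 2))^[b] (ack (2 * N + 2) y) :=
          (ack_mono_right _).iterate _ (hardy_le_ack N q le_rfl fun x hx => hq x (by simp [hx]))
      _ = (ack (2 * N + 2))^[b + 1] y := (Function.iterate_succ_apply _ _ _).symm
      _ ≤ (ack (2 * N + 2))^[a] y := iterate_ack_mono _ _ hab
      _ ≤ (ack (2 * N + 2))^[a] (hardy N p y) := (ack_mono_right _).iterate _ (le_hardy _ _ _)
  | cons d c ih =>
    obtain ⟨N, rfl⟩ : ∃ M, N = M + 1 := ⟨N - 1, by simp at hp; omega⟩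
    exact (ack_mono_right _).iterate _
      (ih (by simpa using hp) fun x hx => hq x (List.mem_cons_of_mem _ hx))

/-! ### Variables, substitutions and weights -/

namespace Term

variable {F : Type*} {ar : F → ℕ} {V : Type*}

/-- The multiset of the variable occurrences in a term. -/
def vars : Term F ar V → Multiset V
  | var x => {x}
  | app _ ts => ∑ i, (ts i).vars

open Classical in
theorem count_vars (x : V) (t : Term F ar V) : t.vars.count x = t.count x := by
  induction t with
  | var y => simp [vars, count, Multiset.count_singleton, eq_comm]
  | app f ts ih => simp [vars, count, Multiset.count_sum', ih]

theorem vars_le_vars {s t : Term F ar V} (h : ∀ x, t.count x ≤ s.count x) : t.vars ≤ s.vars := by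
  classical
  exact Multiset.le_iff_count.2 fun x => by simpa only [count_vars] using h x

theorem vars_iter (f : F) (hf : ar f = 1) (n : ℕ) (t : Term F ar V) :
    (iter f hf n t).vars = t.vars := by
  induction n with
  | zero => rfl
  | succ n ih => simp [iter, vars, ih, hf]

theorem subst_iter (f : F) (hf : ar f = 1) (n : ℕ) (t : Term F ar V) (σ : V → Term F ar V) :
    (iter f hf n t).subst σ = iter f hf n (t.subst σ) := by
  induction n with
  | zero => rfl
  | succ n ih => simp [iter, subst, ih]

theorem size_pos (t : Term F ar V) : 0 < t.size := by
  cases t <;> simp only [size] <;> omega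

end Term

namespace KBO

variable {F : Type*} {ar : F → ℕ} {V : Type*} (O : KBO F ar)

theorem Gt.vars_le {s t : Term F ar V} (h : O.Gt s t) : t.vars ≤ s.vars := by
  cases h with
  | weight _ _ hc _ => exact Term.vars_le_vars hc
  | var f hf n x _ => rw [Term.vars_iter]
  | prec f g ss ts hc _ _ => exact Term.vars_le_vars hc
  | lex f ss ts i hc _ _ _ => exact Term.vars_le_vars hc

theorem w0_le_wt (t : Term F ar V) : O.w0 ≤ O.wt t := by
  induction t with
  | var x => exact le_rfl
  | app f ts ih =>
    rw [wt]
    rcases Nat.eq_zero_or_pos (ar f) with h | h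
    · exact (O.w0_le_const f h).trans (Nat.le_add_right _ _)
    · exact (ih ⟨0, h⟩).trans ((Finset.single_le_sum (f := fun i => O.wt (ts i))
        (fun _ _ => Nat.zero_le _) (Finset.mem_univ _)).trans (Nat.le_add_left _ _))

theorem wt_subst (σ : V → Term F ar V) (t : Term F ar V) :
    O.wt (t.subst σ) = O.wt t + (t.vars.map fun x => O.wt (σ x) - O.w0).sum := by
  induction t with
  | var x =>
    have := O.w0_le_wt (σ x)
    simp only [Term.subst, Term.vars, wt, Multiset.map_singleton, Multiset.sum_singleton]
    omega
  | app f ts ih =>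
    have hsum : ((∑ i, (ts i).vars).map fun x => O.wt (σ x) - O.w0).sum
        = ∑ i, ((ts i).vars.map fun x => O.wt (σ x) - O.w0).sum := by
      rw [← Multiset.coe_mapAddMonoidHom, map_sum, ← Multiset.coe_sumAddMonoidHom, map_sum]
    simp only [Term.subst, Term.vars, wt, ih, hsum, Finset.sum_add_distrib, add_assoc]

theorem wt_subst_le {s t : Term F ar V} (hv : t.vars ≤ s.vars) (σ : V → Term F ar V) :
    O.wt (t.subst σ) + O.wt s ≤ O.wt (s.subst σ) + O.wt t := by
  obtain ⟨m, hm⟩ := Multiset.le_iff_exists_add.1 hv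
  rw [wt_subst, wt_subst, hm, Multiset.map_add, Multiset.sum_add]
  omega

theorem wt_app_of_isSpecial {f : F} (h : O.IsSpecial f) (ts : Fin (ar f) → Term F ar V) :
    O.wt (.app f ts) = O.wt (ts (only h.1)) := by
  have : Subsingleton (Fin (ar f)) := by rw [h.1]; infer_instance
  have h0 : O.weight f = 0 := h.2
  rw [wt, Fintype.sum_subsingleton _ (only h.1)]
  omega

theorem wt_app_le {f : F} {ss ts : Fin (ar f) → Term F ar V} (h : ∀ i, O.wt (ts i) ≤ O.wt (ss i)) :
    O.wt (.app f ts) ≤ O.wt (.app f ss) :=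
  Nat.add_le_add_left (Finset.sum_le_sum fun i _ => h i) _

theorem wt_iter (f : F) (hf : ar f = 1) (n : ℕ) (t : Term F ar V) :
    O.wt (Term.iter f hf n t) = n * O.weight f + O.wt t := by
  induction n with
  | zero => simp [Term.iter]
  | succ n ih => simp [Term.iter, wt, ih, hf]; ring

/-! ### Precedence and ranks -/

theorem not_isSpecial_of_prec {f g : F} (h : O.prec f g) : ¬ O.IsSpecial g := by
  intro hg
  by_cases hfg : f = g
  · subst hfg
    exact O.prec_wf.irrefl.irrefl _ h
  · exact O.prec_wf.irrefl.irrefl f (O.prec_trans _ _ _ h (O.admissible g hg.1 hg.2 f hfg))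

theorem rank_lt_of_prec (hR : O.RanksExist) {f g : F} (hf : ¬ O.IsSpecial f) (h : O.prec f g) :
    O.rank g < O.rank f := by
  rw [O.rank_eq f]
  exact le_csSup (hR f hf) ⟨g, h, rfl⟩

/-! ### Lexicographic descent of the sequences -/

theorem le_sum_wt {f : F} (ts : Fin (ar f) → Term F ar V) (i : Fin (ar f)) :
    O.wt (ts i) + (ar f - 1) ≤ ∑ j, O.wt (ts j) := by
  rw [← Finset.add_sum_erase _ _ (Finset.mem_univ i)]
  refine Nat.add_le_add_left ?_ _
  have h := Finset.card_nsmul_le_sum (Finset.univ.erase i) (fun j => O.wt (ts j)) 1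
    fun j _ => O.w0_pos.trans_le (O.w0_le_wt (ts j))
  simpa using h

theorem length_pad {n : ℕ} {p : List ℕ} (h : p.length ≤ n) : (pad n p).length = n := by
  simp [pad]; omega

theorem ar_lt_base (hA : BddAbove (Set.range ar)) (f : F) : ar f < base ar :=
  Nat.lt_succ_of_le ((le_csSup hA ⟨f, rfl⟩).trans (le_max_left _ _))

theorem four_le_base : 4 ≤ base ar := Nat.succ_le_succ (le_max_right _ _)

/-- The prescribed length `base ar ^ (wt t + 1)` is large enough for the entries: an argument of a
non-special symbol has smaller weight than the whole term. -/
theorem length_twAux (hA : BddAbove (Set.range ar)) (t : Term F ar V) (a : ℕ) :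
    (O.twAux t a).length = base ar ^ (O.wt t + 1) := by
  have hb := four_le_base (ar := ar)
  induction t generalizing a with
  | var x =>
    rw [twAux, wt]
    refine length_pad ?_
    have := Nat.le_self_pow (show O.w0 + 1 ≠ 0 by omega) (base ar)
    simp only [List.length_cons, List.length_nil]
    omega
  | app f ts ih =>
    rw [twAux]
    split_ifs with h
    · rw [ih, wt_app_of_isSpecial O h]
    · refine length_pad ?_
      have hw : 1 ≤ O.wt (.app f ts) := O.w0_pos.trans_le (O.w0_le_wt _)
      have hsum : (List.map List.length (List.ofFn fun i => O.twAux (ts i) 0)).sum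
          ≤ ar f * base ar ^ O.wt (.app f ts) := by
        rw [List.map_ofFn, List.sum_ofFn]
        calc ∑ i, (O.twAux (ts i) 0).length
            ≤ ∑ _i : Fin (ar f), base ar ^ O.wt (.app f ts) := by
              refine Finset.sum_le_sum fun i _ => ?_
              rw [ih]
              refine Nat.pow_le_pow_right (by omega) ?_
              have h1 := O.le_sum_wt ts i
              have h2 : ¬ (ar f = 1 ∧ O.weight f = 0) := h
              have h3 := i.pos
              rw [wt]
              omega
          _ = ar f * base ar ^ O.wt (.app f ts) := by simp
      have h3 := Nat.le_self_pow (n := O.wt (.app f ts)) (by omega) (base ar)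
      have h4 := Nat.mul_le_mul_right (base ar ^ O.wt (.app f ts)) (ar_lt_base hA f)
      rw [List.length_append, List.length_flatten, pow_succ']
      simp only [List.length_cons, List.length_nil]
      rw [Nat.succ_mul] at h4
      omega

theorem exists_twAux_eq (t : Term F ar V) (a : ℕ) :
    ∃ e l, O.twAux t a = O.wt t :: e :: l ∧ a ≤ e := by
  induction t generalizing a with
  | var x => exact ⟨a, _, by rw [twAux, wt]; rfl, le_rfl⟩
  | app f ts ih =>
    by_cases h : O.IsSpecial f
    · obtain ⟨e, l, he, hae⟩ := ih (only h.1) (a + 1)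
      exact ⟨e, l, by rw [twAux, dif_pos h, he, wt_app_of_isSpecial O h], by omega⟩
    · exact ⟨a, _, by rw [twAux, dif_neg h]; rfl, le_rfl⟩

/-- `t` descends to `u`: the weight does not increase and the assigned sequence becomes
lexicographically smaller, whatever the number of special symbols in front. -/
def Descends (t u : Term F ar V) : Prop :=
  O.wt u ≤ O.wt t ∧ ∀ a, LexDrop (O.twAux t a) (O.twAux u a)

theorem descends_of_wt_lt {t u : Term F ar V} (h : O.wt u < O.wt t) : O.Descends t u := by
  refine ⟨h.le, fun a => ?_⟩
  obtain ⟨e, l, he, -⟩ := O.exists_twAux_eq t a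
  obtain ⟨e', l', he', -⟩ := O.exists_twAux_eq u a
  rw [he, he']
  exact LexDrop.head h _ _

theorem lexDrop_twAux_of_lt (t : Term F ar V) {a b : ℕ} (h : b < a) :
    LexDrop (O.twAux t a) (O.twAux t b) := by
  induction t generalizing a b with
  | var x =>
    rw [twAux, twAux]
    exact (LexDrop.head h _ _).append_left [O.w0]
  | app f ts ih =>
    rw [twAux, twAux]
    split_ifs with hf
    · exact ih _ (Nat.succ_lt_succ h)
    · exact (LexDrop.head h _ _).append_left [O.wt (.app f ts)]

theorem twAux_iter {f : F} (h : O.IsSpecial f) (n : ℕ) (t : Term F ar V) (a : ℕ) :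
    O.twAux (Term.iter f h.1 n t) a = O.twAux t (a + n) := by
  induction n generalizing a with
  | zero => rfl
  | succ n ih => rw [Term.iter, twAux, dif_pos h, ih, Nat.add_right_comm, Nat.add_assoc]

theorem descends_app {f : F} {ss ts : Fin (ar f) → Term F ar V} (i : Fin (ar f))
    (hle : O.wt (.app f ts) ≤ O.wt (.app f ss)) (heq : ∀ j < i, ss j = ts j)
    (hi : O.Descends (ss i) (ts i)) : O.Descends (.app f ss) (.app f ts) := by
  rcases hle.lt_or_eq with hlt | hwt
  · exact O.descends_of_wt_lt hlt
  · refine ⟨hle, fun a => ?_⟩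
    rw [twAux, twAux]
    split_ifs with hf
    · have : Subsingleton (Fin (ar f)) := by rw [hf.1]; infer_instance
      rw [Subsingleton.elim (only hf.1) i]
      exact hi.2 _
    · rw [hwt]
      exact ((LexDrop.flatten_ofFn _ _ i (fun j hj => by rw [heq j hj]) (hi.2 0)).append_left
        _).append_right _ _

theorem descends_of_prec (hR : O.RanksExist) {f g : F} {ss : Fin (ar f) → Term F ar V}
    {ts : Fin (ar g) → Term F ar V} (hle : O.wt (.app g ts) ≤ O.wt (.app f ss))
    (h : O.prec f g) : O.Descends (.app f ss) (.app g ts) := by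
  rcases hle.lt_or_eq with hlt | hwt
  · exact O.descends_of_wt_lt hlt
  · refine ⟨hle, fun a => ?_⟩
    rw [twAux, twAux, dif_neg (O.not_isSpecial_of_prec h)]
    split_ifs with hf
    · -- The number of leading special symbols decides.
      obtain ⟨e, l, he, hae⟩ := O.exists_twAux_eq (ss (only hf.1)) (a + 1)
      rw [he, ← wt_app_of_isSpecial O hf, hwt]
      exact (LexDrop.head hae _ _).append_left [O.wt (.app f ss)]
    · rw [hwt]
      exact (LexDrop.head (O.rank_lt_of_prec hR hf h) _ _).append_left [O.wt (.app f ss), a]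

theorem Gt.descends_subst (hR : O.RanksExist) {s t : Term F ar V} (h : O.Gt s t)
    (σ : V → Term F ar V) : O.Descends (s.subst σ) (t.subst σ) := by
  induction h with
  | weight s t hc hw =>
    have := O.wt_subst_le (Term.vars_le_vars hc) σ
    exact O.descends_of_wt_lt (by omega)
  | var f hf n x hw =>
    have hf0 : O.weight f = 0 := by
      rw [wt_iter] at hw
      have : (n + 1) * O.weight f = 0 := by omega
      simpa using this
    rw [Term.subst_iter]
    refine ⟨by rw [wt_iter]; omega, fun a => ?_⟩
    rw [O.twAux_iter ⟨hf, hf0⟩]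
    exact O.lexDrop_twAux_of_lt _ (by omega)
  | prec f g ss ts hc hw hp =>
    have := O.wt_subst_le (Term.vars_le_vars hc) σ
    exact O.descends_of_prec hR (by simp only [Term.subst] at this; omega) hp
  | lex f ss ts i hc hw heq _ ih =>
    have := O.wt_subst_le (Term.vars_le_vars hc) σ
    exact O.descends_app i (by simp only [Term.subst] at this; omega)
      (fun j hj => by rw [heq j hj]) ih

theorem descends_of_step (hR : O.RanksExist) {R : Set (Term F ar V × Term F ar V)}
    (hc : O.Compatible R) {t u : Term F ar V} (h : Step R t u) : O.Descends t u := by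
  induction h with
  | rule l r σ hlr => exact (hc l r hlr).descends_subst O hR σ
  | context f ts i u _ ih =>
    refine O.descends_app i (O.wt_app_le fun j => ?_) (fun j hj => ?_) ?_
    · rcases eq_or_ne j i with rfl | hj
      · simpa using ih.1
      · rw [Function.update_of_ne hj]
    · rw [Function.update_of_ne hj.ne]
    · simpa using ih

/-! ### Control of the entries -/

theorem le_specAux (t : Term F ar V) (a : ℕ) : a ≤ O.specAux t a := by
  induction t generalizing a with
  | var x => exact le_rfl
  | app f ts ih =>
    rw [specAux]
    split_ifs with h
    · exact (Nat.le_succ a).trans (ih _ _)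
    · exact le_max_left _ _

theorem specAux_mono (t : Term F ar V) {a b : ℕ} (h : a ≤ b) :
    O.specAux t a ≤ O.specAux t b := by
  induction t generalizing a b with
  | var x => exact h
  | app f ts ih =>
    rw [specAux, specAux]
    split_ifs with hf
    · exact ih _ (Nat.succ_le_succ h)
    · exact max_le_max_right _ h

theorem specAux_le_add (t : Term F ar V) (a b : ℕ) :
    O.specAux t (a + b) ≤ O.specAux t a + b := by
  induction t generalizing a b with
  | var x => exact le_rfl
  | app f ts ih =>
    rw [specAux, specAux]
    split_ifs with hf
    · rw [Nat.add_right_comm]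
      exact ih _ _ _
    · omega

theorem specAux_arg_le {f : F} (ts : Fin (ar f) → Term F ar V) (i : Fin (ar f)) (a : ℕ) :
    O.specAux (ts i) 0 ≤ O.specAux (.app f ts) a := by
  rw [specAux]
  split_ifs with hf
  · have : Subsingleton (Fin (ar f)) := by rw [hf.1]; infer_instance
    rw [Subsingleton.elim (only hf.1) i]
    exact O.specAux_mono _ (Nat.zero_le _)
  · exact (Finset.le_sup (f := fun i => O.specAux (ts i) 0) (Finset.mem_univ i)).trans
      (le_max_right _ _)

theorem mrk_arg_le {f : F} (ts : Fin (ar f) → Term F ar V) (i : Fin (ar f)) :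
    O.mrk (ts i) ≤ O.mrk (.app f ts) := by
  rw [mrk]
  split_ifs with hf
  · have : Subsingleton (Fin (ar f)) := by rw [hf.1]; infer_instance
    rw [Subsingleton.elim (only hf.1) i]
  · exact (Finset.le_sup (f := fun i => O.mrk (ts i)) (Finset.mem_univ i)).trans
      (le_max_right _ _)

theorem rk_le_mrk_subst (t : Term F ar V) (σ : V → Term F ar V) :
    O.rk t ≤ O.mrk (t.subst σ) := by
  induction t with
  | var x => exact Nat.zero_le _
  | app f ts ih =>
    rw [Term.subst, rk, mrk]
    split_ifs with hf
    · exact ih _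
    · exact le_max_left _ _

theorem mem_vars_app {f : F} {ts : Fin (ar f) → Term F ar V} {x : V} :
    x ∈ (Term.app f ts).vars ↔ ∃ i, x ∈ (ts i).vars := by
  simp [Term.vars, Multiset.mem_sum]

theorem spec_le_of_mem_vars {t : Term F ar V} {x : V} (hx : x ∈ t.vars) (σ : V → Term F ar V) :
    O.specAux (σ x) 0 ≤ O.specAux (t.subst σ) 0 := by
  induction t with
  | var y =>
    obtain rfl : x = y := by simpa [Term.vars] using hx
    exact le_rfl
  | app f ts ih =>
    obtain ⟨i, hi⟩ := mem_vars_app.1 hx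
    exact (ih i hi).trans (O.specAux_arg_le (fun i => (ts i).subst σ) i 0)

theorem mrk_le_of_mem_vars {t : Term F ar V} {x : V} (hx : x ∈ t.vars) (σ : V → Term F ar V) :
    O.mrk (σ x) ≤ O.mrk (t.subst σ) := by
  induction t with
  | var y =>
    obtain rfl : x = y := by simpa [Term.vars] using hx
    exact le_rfl
  | app f ts ih =>
    obtain ⟨i, hi⟩ := mem_vars_app.1 hx
    exact (ih i hi).trans (O.mrk_arg_le (fun i => (ts i).subst σ) i)

theorem specAux_subst_le {t : Term F ar V} {σ : V → Term F ar V} {B : ℕ}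
    (hB : ∀ x ∈ t.vars, O.specAux (σ x) 0 ≤ B) (a : ℕ) :
    O.specAux (t.subst σ) a ≤ O.specAux t a + B := by
  induction t generalizing a with
  | var x =>
    have h1 := O.specAux_le_add (σ x) 0 a
    have h2 := hB x (by simp [Term.vars])
    rw [Nat.zero_add] at h1
    rw [Term.subst, specAux]
    omega
  | app f ts ih =>
    have ih' := fun i => ih i fun x hx => hB x (mem_vars_app.2 ⟨i, hx⟩)
    rw [Term.subst, specAux, specAux]
    split_ifs with hf
    · exact ih' _ _
    · refine max_le (by omega) (Finset.sup_le fun i _ => (ih' i 0).trans ?_)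
      have : O.specAux (ts i) 0 ≤ Finset.univ.sup fun i => O.specAux (ts i) 0 :=
        Finset.le_sup (f := fun i => O.specAux (ts i) 0) (Finset.mem_univ i)
      omega

theorem mrk_subst_le {t : Term F ar V} {σ : V → Term F ar V} {B : ℕ} (ht : O.mrk t ≤ B)
    (hB : ∀ x ∈ t.vars, O.mrk (σ x) ≤ B) : O.mrk (t.subst σ) ≤ B := by
  induction t with
  | var x => exact hB x (by simp [Term.vars])
  | app f ts ih =>
    have ih' := fun i => ih i ((O.mrk_arg_le ts i).trans ht)
      fun x hx => hB x (mem_vars_app.2 ⟨i, hx⟩)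
    rw [Term.subst, mrk]
    rw [mrk] at ht
    split_ifs at ht ⊢ with hf
    · exact ih' _
    · exact max_le ((le_max_left _ _).trans ht) (Finset.sup_le fun i _ => ih' i)

/-- The doubling is needed: in `δ^a (f (δ^a x))` a rule `f x → x` merges the two blocks of special
symbols. -/
theorem specAux_le_of_step {R : Set (Term F ar V × Term F ar V)} (hc : O.Compatible R)
    {K : ℕ} (hK : ∀ l r, (l, r) ∈ R → O.spec r ≤ K) {t u : Term F ar V} (h : Step R t u) (a : ℕ) :
    O.specAux u a ≤ 2 * O.specAux t a + K := by
  induction h generalizing a with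
  | rule l r σ hlr =>
    have h1 := O.specAux_subst_le (t := r) (σ := σ) (B := O.specAux (l.subst σ) 0)
      (fun x hx => O.spec_le_of_mem_vars (Multiset.mem_of_le ((hc l r hlr).vars_le O) hx) σ) a
    have h2 := O.specAux_le_add r 0 a
    have h3 : O.specAux r 0 ≤ K := hK l r hlr
    have h4 := O.le_specAux (l.subst σ) a
    have h5 := O.specAux_mono (l.subst σ) (Nat.zero_le a)
    rw [Nat.zero_add] at h2
    omega
  | context f ts i u _ ih =>
    rw [specAux, specAux]
    split_ifs with hf
    · have : Subsingleton (Fin (ar f)) := by rw [hf.1]; infer_instance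
      rw [Subsingleton.elim (only hf.1) i, Function.update_self]
      exact ih _
    · refine max_le (by omega) (Finset.sup_le fun j _ => ?_)
      have h1 : O.specAux (ts j) 0 ≤ Finset.univ.sup fun i => O.specAux (ts i) 0 :=
        Finset.le_sup (f := fun i => O.specAux (ts i) 0) (Finset.mem_univ j)
      rcases eq_or_ne j i with rfl | hj
      · rw [Function.update_self]
        have := ih 0
        omega
      · rw [Function.update_of_ne hj]
        omega

theorem mrk_le_of_step {R : Set (Term F ar V × Term F ar V)} (hc : O.Compatible R)
    {K : ℕ} (hK : ∀ l r, (l, r) ∈ R → O.mrk r - O.rk l ≤ K) {t u : Term F ar V}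
    (h : Step R t u) : O.mrk u ≤ O.mrk t + K := by
  induction h with
  | rule l r σ hlr =>
    refine O.mrk_subst_le ?_ fun x hx => (O.mrk_le_of_mem_vars
      (Multiset.mem_of_le ((hc l r hlr).vars_le O) hx) σ).trans (Nat.le_add_right _ _)
    have h1 := hK l r hlr
    have h2 := O.rk_le_mrk_subst l σ
    omega
  | context f ts i u _ ih =>
    have hi := O.mrk_arg_le ts i
    rw [mrk]
    split_ifs with hf
    · have : Subsingleton (Fin (ar f)) := by rw [hf.1]; infer_instance
      rw [Subsingleton.elim (only hf.1) i, Function.update_self]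
      omega
    · refine max_le ?_ (Finset.sup_le fun j _ => ?_)
      · rw [mrk, dif_neg hf]
        omega
      · rcases eq_or_ne j i with rfl | hj
        · rw [Function.update_self]
          omega
        · rw [Function.update_of_ne hj]
          exact (O.mrk_arg_le ts j).trans (Nat.le_add_right _ _)

theorem mc_le_iff {p : List ℕ} {m : ℕ} : mc p ≤ m ↔ ∀ x ∈ p, x ≤ m := by
  induction p with
  | nil => simp [mc]
  | cons a p ih =>
    have : mc (a :: p) = max a (mc p) := rfl
    simp [this, ih]

theorem le_mc {p : List ℕ} {x : ℕ} (h : x ∈ p) : x ≤ mc p := mc_le_iff.1 le_rfl x h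

theorem mem_pad {n : ℕ} {p : List ℕ} {x : ℕ} (h : x ∈ pad n p) : x ∈ p ∨ x = 0 := by
  rw [pad, List.mem_append] at h
  exact h.imp_right fun h => (List.mem_replicate.1 h).2

theorem mem_pad_of_mem {n : ℕ} {p : List ℕ} {x : ℕ} (h : x ∈ p) : x ∈ pad n p :=
  List.mem_append_left _ h

theorem le_of_mem_twAux {t : Term F ar V} {a B : ℕ} (hw : O.wt t ≤ B) (hs : O.specAux t a ≤ B)
    (hr : O.mrk t ≤ B) : ∀ x ∈ O.twAux t a, x ≤ B := by
  induction t generalizing a with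
  | var y =>
    intro x hx
    rw [twAux] at hx
    rcases mem_pad hx with hx | rfl
    · rw [wt] at hw
      rw [specAux] at hs
      simp only [List.mem_cons, List.not_mem_nil, or_false] at hx
      omega
    · exact Nat.zero_le _
  | app f ts ih =>
    intro x hx
    rw [twAux] at hx
    split_ifs at hx with hf
    · rw [specAux, dif_pos hf] at hs
      exact ih _ (by rwa [← wt_app_of_isSpecial O hf]) hs ((O.mrk_arg_le ts _).trans hr) x hx
    · rcases mem_pad hx with hx | rfl
      · rw [List.mem_append, List.mem_flatten] at hx
        rcases hx with hx | ⟨p, hp, hx⟩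
        · have h1 := (O.le_specAux (.app f ts) a).trans hs
          have h2 : O.rank f ≤ B := by
            rw [mrk, dif_neg hf] at hr
            exact (le_max_left _ _).trans hr
          simp only [List.mem_cons, List.not_mem_nil, or_false] at hx
          omega
        · obtain ⟨i, rfl⟩ := List.mem_ofFn.1 hp
          have h1 := O.le_sum_wt ts i
          exact ih i (by rw [wt] at hw; omega) ((O.specAux_arg_le ts i a).trans hs)
            ((O.mrk_arg_le ts i).trans hr) x hx
      · exact Nat.zero_le _

theorem wt_le_mc (t : Term F ar V) (a : ℕ) : O.wt t ≤ mc (O.twAux t a) := by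
  obtain ⟨e, l, h, -⟩ := O.exists_twAux_eq t a
  exact le_mc (by simp [h])

theorem mc_arg_le {f : F} (hf : ¬ O.IsSpecial f) (ts : Fin (ar f) → Term F ar V)
    (i : Fin (ar f)) (a : ℕ) : mc (O.twAux (ts i) 0) ≤ mc (O.twAux (.app f ts) a) := by
  refine mc_le_iff.2 fun x hx => le_mc ?_
  rw [twAux, dif_neg hf]
  exact mem_pad_of_mem (List.mem_append_right _
    (List.mem_flatten.2 ⟨_, List.mem_ofFn.2 ⟨i, rfl⟩, hx⟩))

theorem specAux_le_mc (t : Term F ar V) (a : ℕ) : O.specAux t a ≤ mc (O.twAux t a) := by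
  induction t generalizing a with
  | var x =>
    rw [specAux, twAux]
    exact le_mc (mem_pad_of_mem (by simp))
  | app f ts ih =>
    by_cases hf : O.IsSpecial f
    · rw [specAux, dif_pos hf, twAux, dif_pos hf]
      exact ih _ _
    · rw [specAux, dif_neg hf]
      refine max_le ?_ (Finset.sup_le fun i _ => (ih i 0).trans (O.mc_arg_le hf ts i a))
      rw [twAux, dif_neg hf]
      exact le_mc (mem_pad_of_mem (by simp))

theorem mrk_le_mc (t : Term F ar V) (a : ℕ) : O.mrk t ≤ mc (O.twAux t a) := by
  induction t generalizing a with
  | var x => exact Nat.zero_le _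
  | app f ts ih =>
    by_cases hf : O.IsSpecial f
    · rw [mrk, dif_pos hf, twAux, dif_pos hf]
      exact ih _ _
    · rw [mrk, dif_neg hf]
      refine max_le ?_ (Finset.sup_le fun i _ => (ih i 0).trans (O.mc_arg_le hf ts i a))
      rw [twAux, dif_neg hf]
      exact le_mc (mem_pad_of_mem (by simp))

/-! ### Derivation heights -/

theorem ack_le_ack_add (m n : ℕ) : ack m n ≤ ack (m + n) 0 := by
  induction n generalizing m with
  | zero => exact le_rfl
  | succ n ih =>
    exact (ack_succ_right_le_ack_succ_left m n).trans ((ih _).trans_eq (by congr 1; omega))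

theorem length_le_of_derivation (hR : O.RanksExist) (hA : BddAbove (Set.range ar))
    {R : Set (Term F ar V × Term F ar V)} (hc : O.Compatible R) {K : ℕ}
    (hs : ∀ l r, (l, r) ∈ R → O.spec r ≤ K) (hm : ∀ l r, (l, r) ∈ R → O.mrk r - O.rk l ≤ K)
    {n : ℕ} {s : ℕ → Term F ar V} (hstep : ∀ i < n, Step R (s i) (s (i + 1))) :
    n ≤ ack (4 * (O.tw (s 0)).length + mc (O.tw (s 0)) + K) 0 := by
  set N := (O.tw (s 0)).length with hN
  set y := mc (O.tw (s 0)) + K with hy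
  have hy1 : 1 ≤ y :=
    (O.w0_pos.trans_le ((O.w0_le_wt _).trans (O.wt_le_mc (s 0) 0))).trans_le (Nat.le_add_right _ _)
  have control : ∀ i ≤ n, O.wt (s i) ≤ O.wt (s 0) ∧ O.wt (s i) ≤ 2 ^ i * y ∧
      O.specAux (s i) 0 + K ≤ 2 ^ i * y ∧ O.mrk (s i) + K ≤ 2 ^ i * y := by
    intro i
    induction i with
    | zero =>
      intro _
      have h1 := O.wt_le_mc (s 0) 0
      have h2 := O.specAux_le_mc (s 0) 0
      have h3 := O.mrk_le_mc (s 0) 0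
      simp only [pow_zero, one_mul, hy, tw]
      omega
    | succ i ih =>
      intro hi
      obtain ⟨h0, h1, h2, h3⟩ := ih (by omega)
      have hd := (O.descends_of_step hR hc (hstep i hi)).1
      have hd1 := O.specAux_le_of_step hc hs (hstep i hi) 0
      have hd2 := O.mrk_le_of_step hc hm (hstep i hi)
      rw [pow_succ', mul_assoc]
      omega
  have descent : ∀ i ≤ n, hardy N (O.tw (s i)) (2 ^ i * y) ≤ hardy N (O.tw (s 0)) y := by
    intro i
    induction i with
    | zero => simp
    | succ i ih =>
      intro hi
      refine le_trans ?_ (ih (by omega))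
      obtain ⟨-, h1, h2, h3⟩ := control (i + 1) hi
      rw [pow_succ', mul_assoc] at h1 h2 h3 ⊢
      refine hardy_le_of_lexDrop ((O.descends_of_step hR hc (hstep i hi)).2 0) ?_
        (O.le_of_mem_twAux h1 (by omega) (by omega))
      rw [hN, tw, tw, O.length_twAux hA, O.length_twAux hA]
      exact Nat.pow_le_pow_right (Nat.succ_pos _) (Nat.succ_le_succ (control i (by omega)).1)
  have hN1 : 1 ≤ N := by
    rw [hN, tw, O.length_twAux hA]
    exact Nat.pow_pos (Nat.succ_pos _)
  calc n ≤ 2 ^ n * y := (Nat.lt_two_pow_self (n := n)).le.trans (Nat.le_mul_of_pos_right _ hy1)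
    _ ≤ hardy N (O.tw (s n)) (2 ^ n * y) := le_hardy _ _ _
    _ ≤ hardy N (O.tw (s 0)) y := descent n le_rfl
    _ ≤ ack (2 * N + 2) y :=
        hardy_le_ack _ _ (by omega) fun x hx => (le_mc hx).trans (by omega)
    _ ≤ ack (2 * N + 2 + y) 0 := ack_le_ack_add _ _
    _ ≤ ack (4 * N + mc (O.tw (s 0)) + K) 0 := ack_mono_left 0 (by omega)

theorem dh_le (hR : O.RanksExist) (hA : BddAbove (Set.range ar))
    {R : Set (Term F ar V × Term F ar V)} (hc : O.Compatible R) (hK : (O.increases R).Finite)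
    (t : Term F ar V) :
    dh R t ≤ (ack (4 * (O.tw t).length + mc (O.tw t) + sSup (O.increases R)) 0 : ℕ) := by
  refine iSup₂_le fun n ⟨s, hs0, hs⟩ => ?_
  subst hs0
  exact Nat.cast_le.2 (O.length_le_of_derivation hR hA hc
    (fun l r h => le_csSup hK.bddAbove (Or.inl ⟨l, r, h, rfl⟩))
    (fun l r h => le_csSup hK.bddAbove (Or.inr ⟨l, r, h, rfl⟩)) hs)

theorem wt_le_wmax_mul_size (t : Term F ar V) : O.wt t ≤ O.wmax t * t.size := by
  induction t with
  | var x => simp [wt, wmax, Term.size]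
  | app f ts ih =>
    rw [wt, Term.size, mul_add, mul_one, Finset.mul_sum]
    refine Nat.add_le_add (le_max_left _ _) (Finset.sum_le_sum fun i _ => (ih i).trans ?_)
    exact Nat.mul_le_mul_right _ ((Finset.le_sup (f := fun i => O.wmax (ts i))
      (Finset.mem_univ i)).trans (le_max_right _ _))

theorem specAux_le_add_size (t : Term F ar V) (a : ℕ) : O.specAux t a ≤ a + t.size := by
  induction t generalizing a with
  | var x => exact Nat.le_add_right _ _
  | app f ts ih =>
    have hsum : ∀ i, (ts i).size ≤ ∑ j, (ts j).size := fun i =>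
      Finset.single_le_sum (f := fun j => (ts j).size) (fun _ _ => Nat.zero_le _)
        (Finset.mem_univ i)
    rw [specAux, Term.size]
    split_ifs with hf
    · have h1 := ih (only hf.1) (a + 1)
      have h2 := hsum (only hf.1)
      omega
    · refine max_le (by omega) (Finset.sup_le fun i _ => (ih i 0).trans ?_)
      have := hsum i
      omega

theorem mc_tw_le (t : Term F ar V) :
    mc (O.tw t) ≤ (O.wmax t + 1) * t.size + O.mrk t := by
  have h1 := O.wt_le_wmax_mul_size t
  have h2 := O.specAux_le_add_size t 0
  rw [add_one_mul]
  exact mc_le_iff.2 (O.le_of_mem_twAux (by omega) (by omega) (by omega))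

/-- Collects an argument of the Ackermann function into a single power. -/
theorem exponent_le_pow {b W M K n : ℕ} (hb : 1 ≤ b) (hn : 1 ≤ n) :
    4 * b ^ (W * n + 1) + ((W + 1) * n + M) + K
      ≤ (4 * b ^ (W + 1) + 2 * (W + 1) + M + K) ^ n := by
  have h1 : 4 * b ^ (W * n + 1) ≤ (4 * b ^ (W + 1)) ^ n := by
    rw [mul_pow, ← pow_mul]
    refine Nat.mul_le_mul (Nat.le_self_pow (by omega) 4) (Nat.pow_le_pow_right hb ?_)
    rw [add_one_mul]
    omega
  have h2 : (W + 1) * n ≤ (2 * (W + 1)) ^ n := by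
    rw [mul_pow, mul_comm]
    exact Nat.mul_le_mul Nat.lt_two_pow_self.le (Nat.le_self_pow (by omega) _)
  have h3 : M ≤ M ^ n := Nat.le_self_pow (by omega) M
  have h4 : K ≤ K ^ n := Nat.le_self_pow (by omega) K
  have superadd : ∀ x z : ℕ, x ^ n + z ^ n ≤ (x + z) ^ n := fun x z =>
    pow_add_pow_le (Nat.zero_le x) (Nat.zero_le z) (by omega)
  have h5 := superadd (4 * b ^ (W + 1)) (2 * (W + 1))
  have h6 := superadd (4 * b ^ (W + 1) + 2 * (W + 1)) M
  have h7 := superadd (4 * b ^ (W + 1) + 2 * (W + 1) + M) K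
  omega

end KBO

end Rewriting

theorem theoremt :
    ∃ C : ℕ, ∀ (F : Type*) (ar : F → ℕ) (V : Type*) (O : Rewriting.KBO F ar)
      (R : Set (Rewriting.Term F ar V × Rewriting.Term F ar V)),
      O.RanksExist → BddAbove (Set.range ar) → O.Compatible R → (O.increases R).Finite →
      (∀ t : Rewriting.Term F ar V,
        Rewriting.dh R t ≤
          (ack (C * (O.tw t).length + Rewriting.KBO.mc (O.tw t) + sSup (O.increases R)) 0 : ℕ)) ∧
      ∃ c : ℕ → ℕ → ℕ, ∀ t : Rewriting.Term F ar V,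
        Rewriting.dh R t ≤ (ack (c (O.wmax t) (O.mrk t) ^ t.size) 0 : ℕ) := by
  refine ⟨4, fun F ar V O R hR hA hc hK => ⟨O.dh_le hR hA hc hK, fun W M =>
    4 * Rewriting.KBO.base ar ^ (W + 1) + 2 * (W + 1) + M + sSup (O.increases R), fun t => ?_⟩⟩
  refine (O.dh_le hR hA hc hK t).trans (Nat.cast_le.2 (ack_mono_left 0 ?_))
  refine le_trans ?_ (Rewriting.KBO.exponent_le_pow (Nat.succ_pos _) t.size_pos)
  have hlen : (O.tw t).length ≤ Rewriting.KBO.base ar ^ (O.wmax t * t.size + 1) := by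
    rw [Rewriting.KBO.tw, O.length_twAux hA]
    exact Nat.pow_le_pow_right (Nat.succ_pos _) (Nat.succ_le_succ (O.wt_le_wmax_mul_size t))
  have hmc := O.mc_tw_le t
  omega
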